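/- A partial Dyck path is a prefix of a Dyck path, i.e. a lattice path starting at $(0,0)$ with steps $\mathbf{u}=(1,1)$ and $\mathbf{d}=(1,-1)$ that never goes below the $x$-axis. For integers $n,r\ge 0$ let $\mathcal{D}_{n,r}$ be the set of partial Dyck paths from $(0,0)$ to $(2n-r,r)$ (empty if $n<r$). A maximal mountain of such a path is a maximal block of consecutive steps of the form $\mathbf{u}^i\mathbf{d}^j$ with $i,j\ge 1$; it contains exactly one peak (occurrence of $\mathbf{ud}$), and every peak lies in exactly one maximal mountain. The peak is symmetric if $i=j$, and its weight is $\min\{i,j\}$. For integers $n,k,r\ge 0$ let $S^P_{n,k,r}$ be the total number of symmetric peaks of weight $k+1$ in all paths of $\mathcal{D}_{n,r}$, i.e. the number of paths in $\mathcal{D}_{n,r}$ with a distinguished symmetric peak of weight $k+1$. Let $C(x)=\sum_{n\ge 0}\frac{1}{n+1}\binom{2n}{n}x^n$ be the generating function of the Catalan numbers, and let $\sqrt{1-4x}$ denote the formal power series with constant term $1$ whose square is $1-4x$. Theorem. For all integers $k,r\ge 0$, as formal power series, $$\sum_{n\ge 0}S^P_{n,k,r}\,x^n = x^{k+r+1}C(x)^{r+1}\left(1+\frac{(r+1)x}{\sqrt{1-4x}}\right).$$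 Moreover, for all $n\ge k+r+1$ with $(r,n)\ne(0,k+1)$, $$S^P_{n,k,r}=\frac{(r+1)\big((n-k+1)(n-k-r)-2\big)}{\big(2(n-k)-r-2\big)\big(2(n-k)-r-1\big)}\binom{2(n-k)-r-1}{n-k},$$ while in the remaining case $r=0$, $n=k+1$ (where the right-hand side is $0/0$) one has $S^P_{k+1,k,0}=1$. -/

import Mathlib

open PowerSeries

namespace SymPeak

/-- The partial Dyck paths of length `2n - r` ending at level `r`: prefixes of Dyck paths running
from `(0, 0)` to `(2n - r, r)`. The set is empty if `n < r`. -/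
def partialDyckPaths (n r : ℕ) : Set (List DyckStep) :=
  {P | (∃ Q : DyckWord, P <+: Q.toList) ∧ P.length + r = 2 * n ∧
    P.count DyckStep.U = P.count DyckStep.D + r}

/-- `u ^ i d ^ j`, with `i, j ≥ 1`, is a maximal mountain of `P`, whose unique peak is at the point
with abscissa `p` (that is, after the first `p` steps of `P`). Maximality means that the step before
the mountain, if any, is not an up step, and the step after it, if any, is not a down step. -/
def IsMaximalMountain (P : List DyckStep) (p i j : ℕ) : Prop :=
  1 ≤ i ∧ 1 ≤ j ∧ ∃ A B : List DyckStep,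
    P = A ++ List.replicate i DyckStep.U ++ List.replicate j DyckStep.D ++ B ∧
    A.getLast? ≠ some DyckStep.U ∧ B.head? ≠ some DyckStep.D ∧ p = A.length + i

/-- `P` has a symmetric peak of weight `w` at the point with abscissa `p`. -/
def IsSymmetricPeak (P : List DyckStep) (p w : ℕ) : Prop :=
  ∃ i j : ℕ, IsMaximalMountain P p i j ∧ i = j ∧ min i j = w

/-- The partial Dyck paths of length `2n - r` ending at level `r` with a distinguished symmetric
peak of weight `k + 1`, as pairs (path, abscissa of the distinguished peak). -/
def symmetricPeakPaths (n k r : ℕ) : Set (List DyckStep × ℕ) :=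
  {x | x.1 ∈ partialDyckPaths n r ∧ IsSymmetricPeak x.1 x.2 (k + 1)}

/-- There are only finitely many such pairs, so that `Set.ncard` below is the true cardinality. -/
theorem finite_symmetricPeakPaths (n k r : ℕ) : (symmetricPeakPaths n k r).Finite := by
  have : Finite DyckStep := Finite.of_surjective
    (fun b : Bool => if b then DyckStep.U else DyckStep.D) (by
      intro s
      cases s
      · exact ⟨true, rfl⟩
      · exact ⟨false, rfl⟩)
  refine ((List.finite_length_le DyckStep (2 * n)).prod (Set.finite_Iic (2 * n))).subset ?_
  rintro ⟨P, p⟩ ⟨⟨-, hlen, -⟩, i, j, ⟨-, -, A, B, hP, -, -, hp⟩, -, -⟩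
  have h := congrArg List.length hP
  simp only [List.length_append, List.length_replicate] at h
  simp only [Set.mem_prod, Set.mem_ofPred_eq, Set.mem_Iic] at *
  omega

/-- The total number of symmetric peaks of weight `k + 1` in all partial Dyck paths of length
`2n - r` ending at level `r`. -/
noncomputable def numSymmetricPeaks (n k r : ℕ) : ℕ :=
  (symmetricPeakPaths n k r).ncard

/-- The generating function `C(x)` of the Catalan numbers. -/
noncomputable def catalanGF : ℚ⟦X⟧ :=
  PowerSeries.map (Nat.castRingHom ℚ) PowerSeries.catalanSeries

/-- The formal power series `√(1 - 4x)`: the binomial series `(1 + x) ^ (1 / 2)` at `-4x`. -/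
noncomputable def sqrtOneSubFourX : ℚ⟦X⟧ :=
  PowerSeries.rescale (-4 : ℚ) (PowerSeries.binomialSeries ℚ (1 / 2 : ℚ))

theorem sqrtOneSubFourX_sq : sqrtOneSubFourX ^ 2 = 1 - 4 * X := by
  have h : PowerSeries.binomialSeries ℚ (1 / 2 : ℚ) ^ 2 = (1 + X : ℚ⟦X⟧) := by
    rw [sq, ← PowerSeries.binomialSeries_add]
    have := PowerSeries.binomialSeries_nat (R := ℚ) (A := ℚ) 1
    norm_num at this ⊢
    exact this
  rw [sqrtOneSubFourX, ← map_pow, h, map_add, map_one, PowerSeries.rescale_X]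
  have h4 : (PowerSeries.C (-4 : ℚ)) = (-4 : ℚ⟦X⟧) := by
    rw [map_neg]; rfl
  rw [h4]
  ring

theorem constantCoeff_sqrtOneSubFourX : constantCoeff sqrtOneSubFourX = 1 := by
  rw [sqrtOneSubFourX, ← PowerSeries.coeff_zero_eq_constantCoeff_apply, PowerSeries.coeff_rescale]
  simp

end SymPeak

/-!
Removing the mountain `u ^ (k + 1) d ^ (k + 1)` around a distinguished symmetric peak of a path in
`partialDyckPaths n r` leaves a path in `partialDyckPaths (n - k - 1) r` with a marked point that is
neither preceded by an up step nor followed by a down step, and conversely the mountain can be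
inserted at any such point (`symmetricPeakPaths_eq_image`).

The number of such marked points exceeds the number of marked peaks by the number of paths
(`ncard_valleyPaths`): discarding from both sides the points that are followed by `d` but not
preceded by `u`, it remains to compare the points not preceded by `u` (the starting point and the
ends of the down steps) with the points followed by `d` (the starts of the down steps). A marked
peak `ud` can be deleted, which leaves an arbitrary marked point of a path with one up step fewer.
With `b m r` the number of paths in `partialDyckPaths m r`, the number of distinguished symmetric
peaks is therefore `b (q + 1) r + (2 * q + 1 - r) * b q r`, where `q + 1 = n - k - 1`
(`numSymmetricPeaks_succ`).

Splitting off the last step of a path gives a recurrence that determines `b`. It is satisfied by the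
ballot numbers (`numPaths_eq_choose`) and by the coefficients of `X ^ r * C ^ (r + 1)`
(`coeff_X_pow_mul_catalanGF`). The closed formula follows from the former, and the generating
function from the latter together with `C + 2 x C' = C / √(1 - 4x)` (`catalanGF_add_derivative`).
-/

namespace SymPeak

/-! ### Paths that stay above the axis -/

open DyckStep in
/-- The path with steps `P`, started at height `0`, never goes below height `0`. -/
def Nonneg (P : List DyckStep) : Prop :=
  ∀ A : List DyckStep, A <+: P → A.count D ≤ A.count U

open DyckStep in
theorem nonneg_append_iff (A B : List DyckStep) :
    Nonneg (A ++ B) ↔ Nonneg A ∧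
      ∀ B' : List DyckStep, B' <+: B → A.count D + B'.count D ≤ A.count U + B'.count U := by
  constructor
  · intro h
    refine ⟨fun A' hA' => h A' (hA'.trans (List.prefix_append A B)), fun B' hB' => ?_⟩
    simpa using h (A ++ B') ((List.prefix_append_right_inj A).2 hB')
  · rintro ⟨hA, hB⟩ E ⟨F, hF⟩
    rcases List.append_eq_append_iff.1 hF with ⟨G, rfl, -⟩ | ⟨G, rfl, rfl⟩
    · exact hA E (List.prefix_append E G)
    · simpa using hB G (List.prefix_append G F)

open DyckStep in
theorem nonneg_concat_U (P : List DyckStep) : Nonneg (P ++ [U]) ↔ Nonneg P := by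
  refine ⟨fun h => ((nonneg_append_iff _ _).1 h).1, fun h A hA => ?_⟩
  rcases List.prefix_concat_iff.1 hA with rfl | hA
  · have := h P List.prefix_rfl
    simp
    omega
  · exact h A hA

open DyckStep in
theorem nonneg_concat_D (P : List DyckStep) :
    Nonneg (P ++ [D]) ↔ Nonneg P ∧ P.count D + 1 ≤ P.count U := by
  refine ⟨fun h => ⟨((nonneg_append_iff _ _).1 h).1, ?_⟩, fun h A hA => ?_⟩
  · simpa using h _ List.prefix_rfl
  · rcases List.prefix_concat_iff.1 hA with rfl | hA
    · simpa using h.2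
    · exact h.1 A hA

open DyckStep in
theorem nonneg_insert_peak (A B : List DyckStep) :
    Nonneg (A ++ U :: D :: B) ↔ Nonneg (A ++ B) := by
  rw [nonneg_append_iff, nonneg_append_iff]
  refine and_congr_right fun hA => ⟨fun h B' hB' => ?_, fun h B' hB' => ?_⟩
  · have := h (U :: D :: B') (by simpa using hB')
    simp at this
    omega
  · have h0 := hA A List.prefix_rfl
    rcases List.prefix_cons_iff.1 hB' with rfl | ⟨B₁, rfl, hB₁⟩
    · simpa using h0
    rcases List.prefix_cons_iff.1 hB₁ with rfl | ⟨B₂, rfl, hB₂⟩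
    · simp
      omega
    · have := h B₂ hB₂
      simp
      omega

open DyckStep in
/-- The pyramid `u ^ w d ^ w` is built up by inserting peaks `ud`, each at the top of the previous
one. -/
theorem nonneg_insert_pyramid (A B : List DyckStep) (w : ℕ) :
    Nonneg (A ++ List.replicate w U ++ List.replicate w D ++ B) ↔ Nonneg (A ++ B) := by
  induction w generalizing A B with
  | zero => simp
  | succ w ih =>
    have h : A ++ List.replicate (w + 1) U ++ List.replicate (w + 1) D ++ B =
        (A ++ List.replicate w U) ++ U :: D :: (List.replicate w D ++ B) := by
      rw [List.replicate_succ' (a := U), List.replicate_succ]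
      simp
    rw [h, nonneg_insert_peak, ← ih A B]
    simp

open DyckStep in
theorem nonneg_concat_replicate_D (P : List DyckStep) (r : ℕ) (hP : Nonneg P)
    (h : P.count D + r ≤ P.count U) : Nonneg (P ++ List.replicate r D) := by
  induction r with
  | zero => simpa using hP
  | succ r ih =>
    rw [List.replicate_succ', ← List.append_assoc, nonneg_concat_D]
    refine ⟨ih (by omega), ?_⟩
    simp
    omega

theorem length_eq_count_add_count (P : List DyckStep) :
    P.length = P.count DyckStep.U + P.count DyckStep.D := by
  induction P with
  | nil => rfl
  | cons s P ih => cases s <;> simp [ih] <;> omega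

open DyckStep in
/-- Nonnegative paths are exactly the prefixes of Dyck paths, since a nonnegative path can be
completed by down steps. -/
theorem mem_partialDyckPaths {n r : ℕ} {P : List DyckStep} :
    P ∈ partialDyckPaths n r ↔ Nonneg P ∧ P.count U = n ∧ P.count D + r = n := by
  have hl := length_eq_count_add_count P
  constructor
  · rintro ⟨⟨Q, hQ⟩, hlen, hc⟩
    refine ⟨fun A hA => ?_, by omega, by omega⟩
    have := Q.count_D_le_count_U A.length
    rwa [← List.prefix_iff_eq_take.1 (hA.trans hQ)] at this
  · rintro ⟨hP, hU, hD⟩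
    have hQ := nonneg_concat_replicate_D P r hP (by omega)
    refine ⟨⟨⟨P ++ List.replicate r D, ?_, fun i => hQ _ (List.take_prefix i _)⟩,
      List.prefix_append _ _⟩, by omega, by omega⟩
    simp [List.count_replicate]
    omega

/-! ### The number of partial Dyck paths -/

theorem partialDyckPaths_eq_empty {n r : ℕ} (h : n < r) : partialDyckPaths n r = ∅ := by
  ext P
  simp only [mem_partialDyckPaths, Set.mem_empty_iff_false, iff_false]
  omega

theorem finite_partialDyckPaths (n r : ℕ) : (partialDyckPaths n r).Finite := by
  have : Finite DyckStep := Finite.of_surjective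
    (fun b : Bool => if b then DyckStep.U else DyckStep.D) (by
      intro s
      cases s
      · exact ⟨true, rfl⟩
      · exact ⟨false, rfl⟩)
  refine (List.finite_length_le DyckStep (2 * n)).subset ?_
  rintro P ⟨-, hlen, -⟩
  simp only [Set.mem_ofPred_eq]
  omega

/-- The number of partial Dyck paths of length `2n - r` ending at level `r`. -/
noncomputable def numPaths (n r : ℕ) : ℕ := (partialDyckPaths n r).ncard

theorem numPaths_eq_zero {n r : ℕ} (h : n < r) : numPaths n r = 0 := by
  rw [numPaths, partialDyckPaths_eq_empty h, Set.ncard_empty]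

theorem numPaths_zero_zero : numPaths 0 0 = 1 := by
  have : partialDyckPaths 0 0 = {[]} := by
    ext P
    simp only [mem_partialDyckPaths, Set.mem_singleton_iff]
    constructor
    · rintro ⟨-, hU, hD⟩
      have := length_eq_count_add_count P
      exact List.length_eq_zero_iff.1 (by omega)
    · rintro rfl
      simp [Nonneg]
  rw [numPaths, this, Set.ncard_singleton]

theorem concat_U_mem {n r : ℕ} {P : List DyckStep} :
    P ++ [DyckStep.U] ∈ partialDyckPaths (n + 1) (r + 1) ↔ P ∈ partialDyckPaths n r := by
  simp only [mem_partialDyckPaths, nonneg_concat_U]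
  simp
  omega

theorem concat_U_notMem {n : ℕ} {P : List DyckStep} :
    P ++ [DyckStep.U] ∉ partialDyckPaths n 0 := by
  simp only [mem_partialDyckPaths, nonneg_concat_U]
  rintro ⟨h, h1, h2⟩
  have := h P List.prefix_rfl
  simp at h1 h2
  omega

theorem concat_D_mem {n r : ℕ} {P : List DyckStep} :
    P ++ [DyckStep.D] ∈ partialDyckPaths n r ↔ P ∈ partialDyckPaths n (r + 1) := by
  simp only [mem_partialDyckPaths, nonneg_concat_D, and_assoc]
  refine and_congr_right fun _ => ?_
  simp
  omega

theorem concat_injective (s : DyckStep) : Function.Injective fun P : List DyckStep => P ++ [s] :=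
  List.append_left_injective [s]

/-- A nonempty path that ends on the axis ends with a down step. -/
theorem numPaths_succ_zero (n : ℕ) : numPaths (n + 1) 0 = numPaths (n + 1) 1 := by
  have : partialDyckPaths (n + 1) 0 = (· ++ [DyckStep.D]) '' partialDyckPaths (n + 1) 1 := by
    ext P
    rcases List.eq_nil_or_concat P with rfl | ⟨P, s, rfl⟩
    · simp [mem_partialDyckPaths]
    · cases s
      · simp [concat_U_notMem]
      · simp [concat_D_mem]
  rw [numPaths, this, Set.ncard_image_of_injective _ (concat_injective _), numPaths]

/-- A path that ends above the axis is classified by its last step. -/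
theorem numPaths_succ_succ (n r : ℕ) :
    numPaths (n + 1) (r + 1) = numPaths n r + numPaths (n + 1) (r + 2) := by
  have : partialDyckPaths (n + 1) (r + 1) = (· ++ [DyckStep.U]) '' partialDyckPaths n r ∪
      (· ++ [DyckStep.D]) '' partialDyckPaths (n + 1) (r + 2) := by
    ext P
    rcases List.eq_nil_or_concat P with rfl | ⟨P, s, rfl⟩
    · simp [mem_partialDyckPaths]
    · cases s
      · simp [concat_U_mem]
      · simp [concat_D_mem]
  rw [numPaths, this, Set.ncard_union_eq ?_ ((finite_partialDyckPaths _ _).image _)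
      ((finite_partialDyckPaths _ _).image _), Set.ncard_image_of_injective _ (concat_injective _),
    Set.ncard_image_of_injective _ (concat_injective _), numPaths, numPaths]
  · rw [Set.disjoint_left]
    rintro _ ⟨P, -, rfl⟩ ⟨Q, -, h⟩
    simp at h

/-! ### Paths with a marked point -/

/-- The partial Dyck paths with a marked point, encoded as the pair of the part of the path before
the point and the part after it. -/
def markedPaths (n r : ℕ) : Set (List DyckStep × List DyckStep) :=
  {x | x.1 ++ x.2 ∈ partialDyckPaths n r}

theorem markedPaths_eq_image (n r : ℕ) :
    markedPaths n r = (fun x : List DyckStep × ℕ => (x.1.take x.2, x.1.drop x.2)) ''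
      (partialDyckPaths n r ×ˢ Set.Iio (2 * n + 1 - r)) := by
  ext ⟨A, B⟩
  simp only [markedPaths, Set.mem_ofPred_eq, Set.mem_image, Set.mem_prod, Set.mem_Iio, Prod.exists,
    Prod.mk.injEq]
  constructor
  · intro h
    refine ⟨A ++ B, A.length, ⟨h, ?_⟩, by simp, by simp⟩
    have := h.2.1
    rw [List.length_append] at this
    omega
  · rintro ⟨P, i, ⟨hP, -⟩, rfl, rfl⟩
    simpa using hP

theorem finite_markedPaths (n r : ℕ) : (markedPaths n r).Finite := by
  rw [markedPaths_eq_image]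
  exact ((finite_partialDyckPaths n r).prod (Set.finite_Iio _)).image _

/-- A path in `partialDyckPaths n r` has `2n - r` steps, hence `2n - r + 1` points. The truncated
subtraction is harmless: it only truncates when there is no path. -/
theorem ncard_markedPaths (n r : ℕ) :
    (markedPaths n r).ncard = (2 * n + 1 - r) * numPaths n r := by
  rw [markedPaths_eq_image, Set.InjOn.ncard_image, Set.ncard_prod, numPaths, mul_comm]
  · simp
  · rintro ⟨P, i⟩ ⟨hP, hi⟩ ⟨Q, j⟩ ⟨hQ, hj⟩ h
    have hP' := hP.2.1
    have hQ' := hQ.2.1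
    simp only [Prod.mk.injEq, Set.mem_Iio] at h hi hj hP' hQ' ⊢
    have hl := congrArg List.length h.1
    simp only [List.length_take] at hl
    refine ⟨?_, by omega⟩
    rw [← List.take_append_drop i P, h.1, h.2, List.take_append_drop]

theorem insert_pyramid_mem {n r : ℕ} (A B : List DyckStep) (w : ℕ) :
    A ++ List.replicate w DyckStep.U ++ List.replicate w DyckStep.D ++ B ∈
      partialDyckPaths (n + w) r ↔ A ++ B ∈ partialDyckPaths n r := by
  simp only [mem_partialDyckPaths, nonneg_insert_pyramid]
  simp [List.count_replicate]
  omega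

/-- The partial Dyck paths with a marked peak, that is, a marked point between `u` and `d`. -/
def peakPaths (n r : ℕ) : Set (List DyckStep × List DyckStep) :=
  {x ∈ markedPaths n r | x.1.getLast? = some DyckStep.U ∧ x.2.head? = some DyckStep.D}

theorem ncard_peakPaths_zero (r : ℕ) : (peakPaths 0 r).ncard = 0 := by
  rw [peakPaths, Set.ncard_eq_zero ((finite_markedPaths _ _).subset (Set.sep_subset _ _)),
    Set.eq_empty_iff_forall_notMem]
  rintro ⟨A, B⟩ ⟨h, hA, -⟩
  obtain ⟨A, rfl⟩ := List.getLast?_eq_some_iff.1 hA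
  have := (mem_partialDyckPaths.1 h).2.1
  simp at this

/-- Deleting a marked peak `ud` leaves an arbitrary marked point. -/
theorem ncard_peakPaths_succ (n r : ℕ) :
    (peakPaths (n + 1) r).ncard = (2 * n + 1 - r) * numPaths n r := by
  have : peakPaths (n + 1) r = (fun x : List DyckStep × List DyckStep =>
      (x.1 ++ [DyckStep.U], DyckStep.D :: x.2)) '' markedPaths n r := by
    ext ⟨A, B⟩
    simp only [peakPaths, markedPaths, Set.mem_ofPred_eq, Set.mem_image, Prod.exists,
      Prod.mk.injEq]
    constructor
    · rintro ⟨h, hA, hB⟩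
      obtain ⟨A, rfl⟩ := List.getLast?_eq_some_iff.1 hA
      obtain ⟨B, rfl⟩ := List.head?_eq_some_iff.1 hB
      exact ⟨A, B, (insert_pyramid_mem A B 1).1 (by simpa using h), rfl, rfl⟩
    · rintro ⟨A, B, h, rfl, rfl⟩
      exact ⟨by simpa using (insert_pyramid_mem A B 1).2 h, by simp, by simp⟩
  rw [this, Set.ncard_image_of_injective, ncard_markedPaths]
  rintro ⟨A, B⟩ ⟨A', B'⟩ h
  simpa using h

/-- The partial Dyck paths with a marked point that is neither preceded by `u` nor followed by `d`.
Besides the valleys `du`, this includes the starting point if the path does not start with `d`, and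
the end point if the path does not end with `u`. -/
def valleyPaths (n r : ℕ) : Set (List DyckStep × List DyckStep) :=
  {x ∈ markedPaths n r | x.1.getLast? ≠ some DyckStep.U ∧ x.2.head? ≠ some DyckStep.D}

/-- The points not preceded by `u` are the starting point and the ends of the down steps; the latter
are as many as the points followed by `d`. -/
theorem ncard_not_after_U (n r : ℕ) :
    {x ∈ markedPaths n r | x.1.getLast? ≠ some DyckStep.U}.ncard =
      numPaths n r + {x ∈ markedPaths n r | x.2.head? = some DyckStep.D}.ncard := by
  have : {x ∈ markedPaths n r | x.1.getLast? ≠ some DyckStep.U} =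
      (fun P : List DyckStep => (([] : List DyckStep), P)) '' partialDyckPaths n r ∪
        (fun x : List DyckStep × List DyckStep => (x.1 ++ [DyckStep.D], x.2.tail)) ''
          {x ∈ markedPaths n r | x.2.head? = some DyckStep.D} := by
    ext ⟨A, B⟩
    simp only [markedPaths, Set.mem_ofPred_eq, Set.mem_union, Set.mem_image, Prod.exists,
      Prod.mk.injEq]
    constructor
    · rintro ⟨h, hA⟩
      rcases List.eq_nil_or_concat A with rfl | ⟨A, s, rfl⟩
      · exact Or.inl ⟨B, h, rfl, rfl⟩
      · cases s
        · simp at hA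
        · exact Or.inr ⟨A, DyckStep.D :: B, ⟨by simpa using h, rfl⟩, by simp, rfl⟩
    · rintro (⟨B, h, rfl, rfl⟩ | ⟨A, B, ⟨h, hB⟩, rfl, rfl⟩)
      · exact ⟨h, by simp⟩
      · obtain ⟨B, rfl⟩ := List.head?_eq_some_iff.1 hB
        exact ⟨by simpa using h, by simp⟩
  rw [this, Set.ncard_union_eq ?_ ((finite_partialDyckPaths _ _).image _)
      (((finite_markedPaths n r).subset (Set.sep_subset _ _)).image _),
    Set.ncard_image_of_injective, Set.InjOn.ncard_image, numPaths]
  · rintro ⟨A, B⟩ ⟨-, hB⟩ ⟨A', B'⟩ ⟨-, hB'⟩ h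
    obtain ⟨B, rfl⟩ := List.head?_eq_some_iff.1 hB
    obtain ⟨B', rfl⟩ := List.head?_eq_some_iff.1 hB'
    simpa using h
  · intro P Q h
    simpa using h
  · rw [Set.disjoint_left]
    rintro _ ⟨P, -, rfl⟩ ⟨⟨A, B⟩, -, h⟩
    simp at h

theorem ncard_valleyPaths (n r : ℕ) :
    (valleyPaths n r).ncard = numPaths n r + (peakPaths n r).ncard := by
  have hfin (p : List DyckStep × List DyckStep → Prop) : {x ∈ markedPaths n r | p x}.Finite :=
    (finite_markedPaths n r).subset (Set.sep_subset _ _)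
  have h := ncard_not_after_U n r
  have h1 := Set.ncard_inter_add_ncard_sdiff_eq_ncard
    {x ∈ markedPaths n r | x.1.getLast? ≠ some DyckStep.U}
    {x ∈ markedPaths n r | x.2.head? = some DyckStep.D} (hfin _)
  have h2 := Set.ncard_inter_add_ncard_sdiff_eq_ncard
    {x ∈ markedPaths n r | x.2.head? = some DyckStep.D}
    {x ∈ markedPaths n r | x.1.getLast? ≠ some DyckStep.U} (hfin _)
  have e1 : {x ∈ markedPaths n r | x.1.getLast? ≠ some DyckStep.U} \
      {x ∈ markedPaths n r | x.2.head? = some DyckStep.D} = valleyPaths n r := by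
    ext x
    simp [valleyPaths]
    tauto
  have e2 : {x ∈ markedPaths n r | x.2.head? = some DyckStep.D} \
      {x ∈ markedPaths n r | x.1.getLast? ≠ some DyckStep.U} = peakPaths n r := by
    ext x
    simp [peakPaths]
    tauto
  rw [e1] at h1
  rw [e2, Set.inter_comm] at h2
  omega

/-! ### Symmetric peaks -/

theorem symmetricPeakPaths_eq_image (n k r : ℕ) :
    symmetricPeakPaths (n + (k + 1)) k r =
      (fun x : List DyckStep × List DyckStep =>
        (x.1 ++ List.replicate (k + 1) DyckStep.U ++ List.replicate (k + 1) DyckStep.D ++ x.2,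
          x.1.length + (k + 1))) '' valleyPaths n r := by
  ext ⟨P, p⟩
  simp only [symmetricPeakPaths, valleyPaths, markedPaths, Set.mem_ofPred_eq, Set.mem_image,
    Prod.exists, Prod.mk.injEq]
  constructor
  · rintro ⟨hP, i, j, ⟨-, -, A, B, rfl, hA, hB, rfl⟩, rfl, hw⟩
    rw [min_self] at hw
    subst hw
    exact ⟨A, B, ⟨(insert_pyramid_mem A B _).1 hP, hA, hB⟩, rfl, rfl⟩
  · rintro ⟨A, B, ⟨h, hA, hB⟩, rfl, rfl⟩
    exact ⟨(insert_pyramid_mem A B _).2 h, k + 1, k + 1,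
      ⟨by omega, by omega, A, B, rfl, hA, hB, rfl⟩, rfl, min_self _⟩

theorem numSymmetricPeaks_add (n k r : ℕ) :
    numSymmetricPeaks (n + (k + 1)) k r = numPaths n r + (peakPaths n r).ncard := by
  rw [numSymmetricPeaks, symmetricPeakPaths_eq_image, Set.ncard_image_of_injective,
    ncard_valleyPaths]
  rintro ⟨A, B⟩ ⟨A', B'⟩ h
  simp only [Prod.mk.injEq, List.append_assoc] at h
  obtain ⟨rfl, h⟩ := List.append_inj h.1 (by omega)
  simpa using h

theorem numSymmetricPeaks_eq_zero {n k r : ℕ} (h : n < k + 1) : numSymmetricPeaks n k r = 0 := by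
  rw [numSymmetricPeaks, Set.ncard_eq_zero (finite_symmetricPeakPaths n k r),
    Set.eq_empty_iff_forall_notMem]
  rintro ⟨P, p⟩ ⟨hP, i, j, ⟨-, -, A, B, rfl, -⟩, rfl, hw⟩
  rw [min_self] at hw
  have := (mem_partialDyckPaths.1 hP).2.1
  simp [List.count_replicate] at this
  omega

theorem numSymmetricPeaks_base (k r : ℕ) : numSymmetricPeaks (k + 1) k r = numPaths 0 r := by
  have := numSymmetricPeaks_add 0 k r
  rwa [ncard_peakPaths_zero, zero_add, add_zero] at this

theorem numSymmetricPeaks_succ (n k r : ℕ) :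
    numSymmetricPeaks (n + 1 + (k + 1)) k r =
      numPaths (n + 1) r + (2 * n + 1 - r) * numPaths n r := by
  rw [numSymmetricPeaks_add, ncard_peakPaths_succ]

/-! ### Ballot numbers -/

/-- The recurrence given by the last step, with its boundary values, determines `numPaths`. -/
theorem eq_numPaths_of_recurrence (f : ℕ → ℕ → ℚ) (h0 : ∀ n r, n < r → f n r = 0)
    (h1 : f 0 0 = 1) (h2 : ∀ n, f (n + 1) 0 = f (n + 1) 1)
    (h3 : ∀ n r, f (n + 1) (r + 1) = f n r + f (n + 1) (r + 2)) (n r : ℕ) :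
    (numPaths n r : ℚ) = f n r := by
  induction n generalizing r with
  | zero =>
    cases r with
    | zero => simp [numPaths_zero_zero, h1]
    | succ r => rw [numPaths_eq_zero r.succ_pos, h0 _ _ r.succ_pos, Nat.cast_zero]
  | succ n ih =>
    -- Row `n + 1` is filled in from the right, starting at the zeros in the columns `r > n + 1`.
    have key (d : ℕ) : ∀ r, n + 1 < r + d → (numPaths (n + 1) r : ℚ) = f (n + 1) r := by
      induction d with
      | zero =>
        intro r hr
        rw [add_zero] at hr
        rw [numPaths_eq_zero hr, h0 _ _ hr, Nat.cast_zero]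
      | succ d ihd =>
        intro r hr
        cases r with
        | zero => rw [numPaths_succ_zero, h2, ihd 1 (by omega)]
        | succ r =>
          rw [numPaths_succ_succ, h3, Nat.cast_add, ih, ihd (r + 2) (by omega)]
    exact key (n + 2) r (by omega)

/-- The ballot theorem. The case distinction is needed because `2 * n - r` is truncated: for `n = 0`
and `r > 0` the formula would give `r + 1`. -/
theorem numPaths_eq_choose (n r : ℕ) :
    (numPaths n r : ℚ) =
      if r ≤ n then ((r : ℚ) + 1) / (n + 1) * (Nat.choose (2 * n - r) n : ℚ) else 0 := by
  refine eq_numPaths_of_recurrence (fun n r : ℕ =>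
    if r ≤ n then ((r : ℚ) + 1) / (n + 1) * (Nat.choose (2 * n - r) n : ℚ) else 0)
    ?_ ?_ ?_ ?_ n r
  · intro n r h
    simp [h]
  · simp
  · intro n
    have e : Nat.choose (2 * (n + 1)) (n + 1) = 2 * Nat.choose (2 * n + 1) (n + 1) := by
      rw [show 2 * (n + 1) = 2 * n + 1 + 1 by ring, Nat.choose_succ_succ, two_mul (Nat.choose _ _),
        Nat.choose_symm_half]
    simp [e, show 2 * (n + 1) - 1 = 2 * n + 1 by omega]
    ring
  · intro n r
    rcases lt_or_ge n r with h | h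
    · simp [h.not_ge, show ¬ (r + 2 ≤ n + 1) by omega]
    · obtain ⟨d, rfl⟩ := Nat.exists_eq_add_of_le h
      have e := Nat.choose_succ_right_eq (r + 2 * d) (r + d)
      rw [show r + 2 * d - (r + d) = d by omega] at e
      have e' : (Nat.choose (r + 2 * d) (r + d + 1) : ℚ) =
          Nat.choose (r + 2 * d) (r + d) * d / (r + d + 1) := by
        rw [eq_div_iff (by positivity)]
        exact_mod_cast e
      -- At `r = n` the condition of the last term fails, but its binomial coefficient vanishes too.
      have hlast : (if r + 2 ≤ r + d + 1 then ((r + 2 : ℕ) + 1 : ℚ) / ((r + d + 1 : ℕ) + 1) *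
          (Nat.choose (2 * (r + d + 1) - (r + 2)) (r + d + 1) : ℚ) else 0) =
          ((r : ℚ) + 3) / (r + d + 2) * (Nat.choose (r + 2 * d) (r + d + 1) : ℚ) := by
        cases d with
        | zero => simp
        | succ d =>
          rw [if_pos (by omega),
            show 2 * (r + (d + 1) + 1) - (r + 2) = r + 2 * (d + 1) by omega]
          push_cast
          ring
      rw [hlast, if_pos (by omega), if_pos (by omega),
        show 2 * (r + d + 1) - (r + 1) = r + 2 * d + 1 by omega,
        show 2 * (r + d) - r = r + 2 * d by omega, Nat.choose_succ_succ]
      push_cast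
      rw [e']
      field_simp
      ring

/-! ### Generating functions -/

theorem catalanGF_eq : catalanGF = 1 + X * catalanGF ^ 2 := by
  have := congrArg (PowerSeries.map (Nat.castRingHom ℚ)) catalanSeries_sq_mul_X_add_one
  simp only [map_add, map_mul, map_pow, map_one, PowerSeries.map_X] at this
  rw [catalanGF]
  linear_combination -this

theorem coeff_X_pow_mul_catalanGF (n r : ℕ) :
    coeff n (X ^ r * catalanGF ^ (r + 1)) = (numPaths n r : ℚ) := by
  symm
  refine eq_numPaths_of_recurrence (fun n r => coeff n (X ^ r * catalanGF ^ (r + 1)))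
    ?_ ?_ ?_ ?_ n r
  · intro n r h
    simp [coeff_X_pow_mul', h.not_ge]
  · simp [catalanGF]
  · intro n
    have : X ^ 0 * catalanGF ^ (0 + 1) = 1 + X ^ 1 * catalanGF ^ (1 + 1) := by
      linear_combination catalanGF_eq
    simp only [this, map_add, coeff_one]
    simp
  · intro n r
    have : X ^ (r + 1) * catalanGF ^ (r + 1 + 1) =
        X * (X ^ r * catalanGF ^ (r + 1)) + X ^ (r + 2) * catalanGF ^ (r + 2 + 1) := by
      linear_combination (X ^ (r + 1) * catalanGF ^ (r + 1)) * catalanGF_eq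
    simp only [this, map_add, coeff_succ_X_mul]

/-- Both sides are square roots of `1 - 4x` with constant coefficient `1`. -/
theorem sqrtOneSubFourX_eq : sqrtOneSubFourX = 1 - 2 * X * catalanGF := by
  have h : (sqrtOneSubFourX - (1 - 2 * X * catalanGF)) *
      (sqrtOneSubFourX + (1 - 2 * X * catalanGF)) = 0 := by
    linear_combination sqrtOneSubFourX_sq + 4 * X * catalanGF_eq
  rcases mul_eq_zero.1 h with h | h
  · exact sub_eq_zero.1 h
  · have := congrArg constantCoeff h
    simp [constantCoeff_sqrtOneSubFourX] at this

theorem sqrtOneSubFourX_mul_inv : sqrtOneSubFourX * sqrtOneSubFourX⁻¹ = 1 :=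
  PowerSeries.mul_inv_cancel _ (by simp [constantCoeff_sqrtOneSubFourX])

theorem catalanGF_add_derivative :
    catalanGF + 2 * X * d⁄dX ℚ catalanGF = catalanGF * sqrtOneSubFourX⁻¹ := by
  have hd : d⁄dX ℚ catalanGF = catalanGF ^ 2 + 2 * X * catalanGF * d⁄dX ℚ catalanGF := by
    conv_lhs => rw [catalanGF_eq]
    simp [Derivation.leibniz, pow_two]
    ring
  have h := sqrtOneSubFourX_mul_inv
  rw [sqrtOneSubFourX_eq] at h ⊢
  linear_combination (-(catalanGF + 2 * X * d⁄dX ℚ catalanGF)) * h +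
    2 * X * (1 - 2 * X * catalanGF)⁻¹ * hd

/-- The number of points `2n - r + 1` of a path turns into the operator `2 x d/dx + (1 - r)` acting
on the generating function of the paths. -/
theorem mk_marked_eq (r : ℕ) :
    (PowerSeries.mk fun n => (2 * (n : ℚ) + 1 - r) * numPaths n r) =
      ((r : ℚ⟦X⟧) + 1) * X ^ r * catalanGF ^ (r + 1) * sqrtOneSubFourX⁻¹ := by
  have h : (PowerSeries.mk fun n => (2 * (n : ℚ) + 1 - r) * numPaths n r) =
      2 * (X * d⁄dX ℚ (X ^ r * catalanGF ^ (r + 1))) +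
        (1 - (r : ℚ⟦X⟧)) * (X ^ r * catalanGF ^ (r + 1)) := by
    ext n
    have e2 : (2 : ℚ⟦X⟧) = PowerSeries.C 2 := (map_ofNat PowerSeries.C 2).symm
    have er : (1 - (r : ℚ⟦X⟧)) = PowerSeries.C (1 - (r : ℚ)) := by simp
    rw [map_add, e2, er, coeff_C_mul, coeff_C_mul, coeff_X_pow_mul_catalanGF, coeff_mk]
    cases n with
    | zero => simp
    | succ n =>
      rw [coeff_succ_X_mul, coeff_derivative, coeff_X_pow_mul_catalanGF]
      push_cast
      ring
  have hX : X * d⁄dX ℚ (X ^ r * catalanGF ^ (r + 1)) = (r : ℚ⟦X⟧) * X ^ r * catalanGF ^ (r + 1) +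
      ((r : ℚ⟦X⟧) + 1) * X ^ (r + 1) * catalanGF ^ r * d⁄dX ℚ catalanGF := by
    cases r with
    | zero => simp
    | succ r =>
      simp [Derivation.leibniz, Derivation.leibniz_pow]
      ring
  rw [h, hX]
  linear_combination ((r : ℚ⟦X⟧) + 1) * X ^ r * catalanGF ^ r * catalanGF_add_derivative

/-- For `n < r` both the truncated and the rational factor are multiplied by zero. -/
theorem cast_numSymmetricPeaks_succ (n k r : ℕ) :
    (numSymmetricPeaks (n + 1 + (k + 1)) k r : ℚ) =
      numPaths (n + 1) r + (2 * (n : ℚ) + 1 - r) * numPaths n r := by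
  rw [numSymmetricPeaks_succ]
  rcases lt_or_ge n r with h | h
  · simp [numPaths_eq_zero h]
  · push_cast [show r ≤ 2 * n + 1 by omega]
    ring

theorem mk_numSymmetricPeaks_eq (k r : ℕ) :
    (PowerSeries.mk fun n => (numSymmetricPeaks n k r : ℚ)) =
      X ^ (k + 1) * (X ^ r * catalanGF ^ (r + 1) +
        X * PowerSeries.mk fun n => (2 * (n : ℚ) + 1 - r) * numPaths n r) := by
  ext n
  rw [coeff_mk, coeff_X_pow_mul']
  split_ifs with h
  · obtain ⟨m, rfl⟩ := Nat.exists_eq_add_of_le' h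
    rw [Nat.add_sub_cancel, map_add, coeff_X_pow_mul_catalanGF]
    cases m with
    | zero => simp [numSymmetricPeaks_base]
    | succ m => rw [coeff_succ_X_mul, coeff_mk, cast_numSymmetricPeaks_succ]
  · rw [numSymmetricPeaks_eq_zero (not_le.1 h), Nat.cast_zero]

/-- The closed formula, with all binomial coefficients expressed by `(2q + 3 - r).choose (q + 2)`.
For `r = q + 1` there is no path in `partialDyckPaths q r`, and this case is separate. -/
theorem numPaths_add_marked_eq_choose (q r : ℕ) (h : r ≤ q + 1) :
    (numPaths (q + 1) r : ℚ) + (2 * (q : ℚ) + 1 - r) * numPaths q r =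
      ((r : ℚ) + 1) * (((q : ℚ) + 3) * (q + 2 - r) - 2) / ((2 * (q : ℚ) + 2 - r) * (2 * q + 3 - r)) *
        (Nat.choose (2 * q + 3 - r) (q + 2) : ℚ) := by
  rw [numPaths_eq_choose, numPaths_eq_choose, if_pos h]
  rcases h.eq_or_lt with rfl | h'
  · rw [if_neg (by omega), show 2 * (q + 1) - (q + 1) = q + 1 by omega,
      show 2 * q + 3 - (q + 1) = q + 2 by omega, Nat.choose_self, Nat.choose_self]
    push_cast
    rw [show (2 * (q : ℚ) + 2 - (q + 1)) = q + 1 by ring,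
      show (2 * (q : ℚ) + 3 - (q + 1)) = q + 2 by ring]
    field_simp
    ring
  · obtain ⟨d, rfl⟩ := Nat.exists_eq_add_of_le (Nat.lt_succ_iff.1 h')
    rw [if_pos (by omega), show 2 * (r + d + 1) - r = r + 2 * d + 2 by omega,
      show 2 * (r + d) - r = r + 2 * d by omega,
      show 2 * (r + d) + 3 - r = r + 2 * d + 3 by omega]
    have e1 : ((r : ℚ) + 2 * d + 3) * (Nat.choose (r + 2 * d + 2) (r + d + 1) : ℚ) =
        Nat.choose (r + 2 * d + 3) (r + d + 2) * (r + d + 2) := by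
      exact_mod_cast Nat.add_one_mul_choose_eq (r + 2 * d + 2) (r + d + 1)
    have e2 : ((r : ℚ) + 2 * d + 2) * (Nat.choose (r + 2 * d + 1) (r + d) : ℚ) =
        Nat.choose (r + 2 * d + 2) (r + d + 1) * (r + d + 1) := by
      exact_mod_cast Nat.add_one_mul_choose_eq (r + 2 * d + 1) (r + d)
    have e3 : (Nat.choose (r + 2 * d) (r + d) : ℚ) * (r + 2 * d + 1) =
        Nat.choose (r + 2 * d + 1) (r + d) * (d + 1) := by
      have := Nat.choose_mul_succ_eq (r + 2 * d) (r + d)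
      rw [show r + 2 * d + 1 - (r + d) = d + 1 by omega] at this
      exact_mod_cast this
    have f3 : (Nat.choose (r + 2 * d) (r + d) : ℚ) =
        Nat.choose (r + 2 * d + 1) (r + d) * (d + 1) / (r + 2 * d + 1) := by
      rw [eq_div_iff (by positivity), e3]
    have f2 : (Nat.choose (r + 2 * d + 1) (r + d) : ℚ) =
        Nat.choose (r + 2 * d + 2) (r + d + 1) * (r + d + 1) / (r + 2 * d + 2) := by
      rw [eq_div_iff (by positivity), ← e2]
      ring
    have f1 : (Nat.choose (r + 2 * d + 2) (r + d + 1) : ℚ) =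
        Nat.choose (r + 2 * d + 3) (r + d + 2) * (r + d + 2) / (r + 2 * d + 3) := by
      rw [eq_div_iff (by positivity), ← e1]
      ring
    rw [f3, f2, f1]
    push_cast
    rw [show (2 * ((r : ℚ) + d) + 2 - r) = r + 2 * d + 2 by ring,
      show (2 * ((r : ℚ) + d) + 3 - r) = r + 2 * d + 3 by ring,
      show (2 * ((r : ℚ) + d) + 1 - r) = r + 2 * d + 1 by ring]
    field_simp
    ring

end SymPeak

theorem theorem4p1p3 (k r : ℕ) :
    (PowerSeries.mk fun n => (SymPeak.numSymmetricPeaks n k r : ℚ)) =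
      (X : ℚ⟦X⟧) ^ (k + r + 1) * SymPeak.catalanGF ^ (r + 1) *
        (1 + ((r : ℚ⟦X⟧) + 1) * X * SymPeak.sqrtOneSubFourX⁻¹) ∧
    (∀ n : ℕ, k + r + 1 ≤ n → ¬ (r = 0 ∧ n = k + 1) →
      (SymPeak.numSymmetricPeaks n k r : ℚ) =
        ((r : ℚ) + 1) * (((n : ℚ) - k + 1) * ((n : ℚ) - k - r) - 2) /
          ((2 * ((n : ℚ) - k) - r - 2) * (2 * ((n : ℚ) - k) - r - 1)) *
          (Nat.choose (2 * (n - k) - r - 1) (n - k) : ℚ)) ∧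
    (r = 0 → SymPeak.numSymmetricPeaks (k + 1) k r = 1) := by
  refine ⟨?_, fun n hn h0 => ?_, ?_⟩
  · rw [SymPeak.mk_numSymmetricPeaks_eq, SymPeak.mk_marked_eq]
    ring
  -- The excluded case is exactly `n = k + 1`, where no path with one up step fewer exists.
  · obtain ⟨q, rfl⟩ : ∃ q, n = q + 1 + (k + 1) := ⟨n - (k + 2), by omega⟩
    rw [SymPeak.cast_numSymmetricPeaks_succ, SymPeak.numPaths_add_marked_eq_choose q r (by omega),
      show q + 1 + (k + 1) - k = q + 2 by omega,
      show 2 * (q + 2) - r - 1 = 2 * q + 3 - r by omega]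
    push_cast
    ring_nf
  · rintro rfl
    rw [SymPeak.numSymmetricPeaks_base, SymPeak.numPaths_zero_zero]
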